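/- Let $(Z,d)$ be a compact, connected metric space with more than one point that is Ahlfors regular, i.e. for some $Q>0$ it carries a Borel measure $\mu$ and constants $c,C>0$ with $c\,r^{Q}\le\mu(B(z,r))\le C\,r^{Q}$ for all $z\in Z$ and $0<r\le\operatorname{diam}Z$. Normalise the metric so that $\operatorname{diam}(Z)=1$ (everything below is defined after this rescaling). A hyperbolic filling $X=(V_X,E_X)$ of $Z$ with parameter $s>1$ is the following graph. For each $k\ge 1$ choose a maximal $s^{-k}$-separated set $Z_k\subseteq Z$, and let $Z_0$ consist of a single point; the vertices of level $k$ are the points $v\in Z_k$, with balls $B_v=B(v,2s^{-k})$ of radius $r(v)=2s^{-k}$. Distinct vertices $v,w$ are joined by an edge iff their levels differ by at most $1$ and $B_v\cap B_w\ne\emptyset$. A two-sided infinite path $(v_k)_{k\in\mathbb Z}$ has limits in $A$ and $B$ if $v_k$ tends in $Z$ to a point of $A$ as $k\to-\infty$ and to a point of $B$ as $k\to\infty$, with $r(v_k)\to0$ in both directions. For open sets $A,B\subseteq Z$ that are positively separated, i.e. $\operatorname{dist}(A,B)>0$ (where $\operatorname{dist}(A,B)=\infty$ if one of them is empty), call $\tau\colon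 E_X\to[0,\infty)$ admissible if $\sum_{e\in\gamma}\tau(e)\ge1$ for every two-sided infinite path $\gamma$ in $X$ with limits in $A$ and $B$. For $p>1$ put $$\operatorname{wcap}_p(A,B)=\inf\{\|\tau\|_{p,\infty}^p:\ \tau\text{ admissible}\},$$ where $\|\tau\|_{p,\infty}$ is the infimum of all $C>0$ with $\#\{e:\tau(e)>\lambda\}\le C^p/\lambda^p$ for all $\lambda>0$ (and $\infty$ if there is none). Let $\Delta(A,B)=\operatorname{dist}(A,B)/\min(\operatorname{diam}A,\operatorname{diam}B)$ and, for $t>0$, $\varphi_p(t)=\sup\{\operatorname{wcap}_p(A,B):\ A,B\text{ open, positively separated},\ \Delta(A,B)\ge t\}$. Define $$Q_w(Z)=\inf\{p>1:\ \operatorname{wcap}_p(A,B)<\infty\text{ for all positively separated open }A,B\},$$ $$Q_w'(Z)=\inf\{p>1:\ \varphi_p(t_0)<\infty\text{ for some }t_0>0\}.$$ Let $\operatorname{ARCdim}(Z)$ be the infimum of the Hausdorff dimensions $\dim_H(Z,\theta)$ over all metrics $\theta$ on $Z$ such that $(Z,\theta)$ is Ahlfors regular and the identity $(Z,d)\to(Z,\theta)$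 is a quasisymmetry, i.e. a homeomorphism such that for some increasing $\eta\colon(0,\infty)\to(0,\infty)$ with $\lim_{t\to0}\eta(t)=0$ one has $\theta(x,y)/\theta(x,z)\le\eta(d(x,y)/d(x,z))$ for all $x,y,z\in Z$ with $y\neq x\ne z$. Then, for every hyperbolic filling $X$ of $Z$ (with any parameter $s>1$ and any choice of the sets $Z_k$) used to define the exponents, $$Q_w'(Z)\le\operatorname{ARCdim}(Z)\qquad\text{and}\qquad Q_w(Z)\le\operatorname{ARCdim}(Z).$$ -/

import Mathlib

open Set Filter Topology MeasureTheory
open scoped NNReal ENNReal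

noncomputable section

/-- A metric space is Ahlfors `Q`-regular if it carries a Borel measure `μ` with
`c r ^ Q ≤ μ (B(z, r)) ≤ C r ^ Q` for all points `z` and all `0 < r ≤ diam Z`. -/
def IsAhlforsRegular (Z : Type*) [MetricSpace Z] (Q : ℝ) : Prop :=
  0 < Q ∧ ∃ μ : @Measure Z (borel Z), ∃ c C : ℝ, 0 < c ∧ 0 < C ∧
    ∀ (z : Z) (r : ℝ), 0 < r → ENNReal.ofReal r ≤ Metric.ediam (univ : Set Z) →
      ENNReal.ofReal (c * r ^ Q) ≤ μ (Metric.ball z r) ∧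
        μ (Metric.ball z r) ≤ ENNReal.ofReal (C * r ^ Q)

/-- A quasisymmetry: a homeomorphism `f` for which there is an increasing function
`η : (0, ∞) → (0, ∞)` with `η t → 0` as `t → 0` that controls ratios of distances.
For `x = y` the left-hand side is `0`, so that case is omitted. -/
def IsQuasisymmetry {Z W : Type*} [MetricSpace Z] [MetricSpace W] (f : Z → W) : Prop :=
  IsHomeomorph f ∧ ∃ η : ℝ → ℝ,
    MonotoneOn η (Ioi 0) ∧ (∀ t, 0 < t → 0 < η t) ∧ Tendsto η (𝓝[>] 0) (𝓝 0) ∧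
      ∀ x y z : Z, x ≠ y → x ≠ z →
        dist (f x) (f y) / dist (f x) (f z) ≤ η (dist x y / dist x z)

/-- The Ahlfors regular conformal dimension: the infimum of the Hausdorff dimensions of
`(Z, θ)` over all metrics `θ` on `Z` such that `(Z, θ)` is Ahlfors regular and the identity map
`(Z, d) → (Z, θ)` is a quasisymmetry. -/
def arcDim (Z : Type*) [d : MetricSpace Z] : ℝ≥0∞ :=
  ⨅ (θ : MetricSpace Z) (_ : @IsQuasisymmetry Z Z d θ id ∧ ∃ Q : ℝ, @IsAhlforsRegular Z θ Q),
    @dimH Z θ.toEMetricSpace univ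

/-- The data of a hyperbolic filling of `Z` with scaling parameter `s > 1`: for each `k ≥ 1` a
maximal `s ^ (-k)`-separated set of points, where distances are measured relative to `diam Z`
(that is, after rescaling the metric so that `diam Z = 1`), and one single point for `k = 0`. -/
structure HyperbolicFilling (Z : Type*) [MetricSpace Z] where
  s : ℝ
  one_lt_s : 1 < s
  pts : ℕ → Set Z
  pts_zero : ∃ o : Z, pts 0 = {o}
  pts_maximal : ∀ k : ℕ, 1 ≤ k →
    Maximal (fun S : Set Z =>
      S.Pairwise fun x y => Metric.diam (univ : Set Z) * s⁻¹ ^ k ≤ dist x y) (pts k)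

namespace HyperbolicFilling

variable {Z : Type*} [MetricSpace Z] (X : HyperbolicFilling Z)

/-- A vertex is a level together with one of the chosen points of that level. -/
def Vertex : Type _ := Σ k : ℕ, X.pts k

variable {X}

def Vertex.level (v : X.Vertex) : ℕ := v.1

def Vertex.center (v : X.Vertex) : Z := v.2

/-- The radius `2 s ^ (-k)` (relative to `diam Z`) of the ball of a vertex of level `k`. -/
def Vertex.radius (v : X.Vertex) : ℝ := 2 * (Metric.diam (univ : Set Z) * X.s⁻¹ ^ v.level)

/-- The ball `B_v` of a vertex; for the vertex of level `0` and compact `Z` with more than one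
point it is all of `Z`. -/
def Vertex.ball (v : X.Vertex) : Set Z := Metric.ball v.center v.radius

variable (X)

/-- Distinct vertices are joined by an edge iff their levels differ by at most one and their
balls meet. -/
def graph : SimpleGraph X.Vertex where
  Adj v w := v ≠ w ∧ (v.level ≤ w.level + 1 ∧ w.level ≤ v.level + 1) ∧ (v.ball ∩ w.ball).Nonempty
  symm := ⟨fun _ _ h => ⟨h.1.symm, ⟨h.2.1.2, h.2.1.1⟩, by rw [inter_comm]; exact h.2.2⟩⟩
  loopless := ⟨fun _ h => h.1 rfl⟩

abbrev Edge : Type _ := X.graph.edgeSet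

/-- A two-sided infinite path, given by its sequence of vertices. -/
structure BiPath where
  vertex : ℤ → X.Vertex
  adj : ∀ k, X.graph.Adj (vertex k) (vertex (k + 1))

variable {X}

def BiPath.edge (γ : X.BiPath) (k : ℤ) : X.Edge := ⟨s(γ.vertex k, γ.vertex (k + 1)), γ.adj k⟩

/-- The path converges to `z` along `l` (`atBot` or `atTop`): the centers tend to `z` and the radii
tend to `0`. -/
def BiPath.HasLimit (γ : X.BiPath) (l : Filter ℤ) (z : Z) : Prop :=
  Tendsto (fun k => (γ.vertex k).center) l (𝓝 z) ∧ Tendsto (fun k => (γ.vertex k).radius) l (𝓝 0)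

variable (X)

/-- `τ` is admissible for `A` and `B` if it has total mass at least `1` along every path with one
limit in `A` and the other in `B` (reversing a path does not change the mass). -/
def IsAdmissible (A B : Set Z) (τ : X.Edge → ℝ≥0) : Prop :=
  ∀ γ : X.BiPath, (∃ a ∈ A, γ.HasLimit atBot a) → (∃ b ∈ B, γ.HasLimit atTop b) →
    1 ≤ ∑' k : ℤ, (τ (γ.edge k) : ℝ≥0∞)

end HyperbolicFilling

/-- The weak `ℓ^p` quasinorm: the infimum of all real `C > 0` with `#{f > l} ≤ C ^ p / l ^ p` for
all `l > 0`, and `∞` if there is no such `C`. -/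
def weakNorm {V : Type*} (p : ℝ) (f : V → ℝ≥0) : ℝ≥0∞ :=
  ⨅ (C : ℝ≥0) (_ : 0 < C ∧ ∀ l : ℝ≥0, 0 < l →
      (({x : V | l < f x}.encard : ℕ∞) : ℝ≥0∞) ≤ (C : ℝ≥0∞) ^ p / (l : ℝ≥0∞) ^ p), (C : ℝ≥0∞)

/-- The distance `inf {d(a, b) : a ∈ A, b ∈ B}` of two sets (`∞` if one of them is empty). -/
def setDist {Z : Type*} [MetricSpace Z] (A B : Set Z) : ℝ≥0∞ := ⨅ a ∈ A, ⨅ b ∈ B, edist a b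

/-- The relative distance `dist(A, B) / min(diam A, diam B)`. -/
def relDist {Z : Type*} [MetricSpace Z] (A B : Set Z) : ℝ≥0∞ :=
  setDist A B / min (Metric.ediam A) (Metric.ediam B)

namespace HyperbolicFilling

variable {Z : Type*} [MetricSpace Z] (X : HyperbolicFilling Z)

/-- The weak `p`-capacity of `A` and `B`. -/
def weakCap (p : ℝ) (A B : Set Z) : ℝ≥0∞ :=
  ⨅ (τ : X.Edge → ℝ≥0) (_ : X.IsAdmissible A B τ), weakNorm p τ ^ p

/-- The control function `φ_p(t) = sup {wcap_p(A, B) : Δ(A, B) ≥ t}` over positively separated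
open sets. -/
def control (p t : ℝ) : ℝ≥0∞ :=
  ⨆ (A : Set Z) (B : Set Z)
    (_ : IsOpen A ∧ IsOpen B ∧ 0 < setDist A B ∧ ENNReal.ofReal t ≤ relDist A B), X.weakCap p A B

/-- The critical exponent `Q_w`: the infimum of the `p > 1` for which all positively separated open
sets have finite weak `p`-capacity. -/
def Qw : ℝ≥0∞ :=
  ⨅ (p : ℝ) (_ : 1 < p ∧ ∀ A B : Set Z, IsOpen A → IsOpen B → 0 < setDist A B →
      X.weakCap p A B < ∞), ENNReal.ofReal p

/-- The critical exponent of the control functions: the infimum of the `p > 1` for which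
`φ_p(t₀) < ∞` for some `t₀ > 0`. -/
def Qw' : ℝ≥0∞ :=
  ⨅ (p : ℝ) (_ : 1 < p ∧ ∃ t₀ : ℝ, 0 < t₀ ∧ X.control p t₀ < ∞), ENNReal.ofReal p

end HyperbolicFilling

end

/-! Let `f : Z → W` be a quasisymmetry onto a `Q`-regular space. Since `max 1 Q ≤ dimH W`, it
suffices that every `p > max 1 Q` satisfies the finiteness conditions defining both exponents.

Give each vertex `v` the gauge `ρ(v)`, the size in `W` of the image of a ball of scale `v.level`
around its center. Quasisymmetry makes gauges of adjacent vertices comparable and makes gauges over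
a fixed point decay geometrically in the level. With `μ` the regular measure of `W`, `ρ(v) ^ p` is
at most a constant times `ρ(v) ^ (p - Q) * μ(B v)`, where the small balls `B v` around `f v.center`
are disjoint within each level. Integrating `∑ ρ(v) ^ (p - Q)` over these balls bounds the sum of `ρ
^ p` over the vertices in a ball of radius `R` by `S * R ^ p` (`exists_sum_gauge_rpow_le`).

The gradient of a vertex function whose limits along a path differ by at least `1` is admissible. If
it is at most `L * ρ` and lives in an `R`-ball, bounded degree gives capacity at most a constant
times `(L * R) ^ p`, plus `1` (`exists_weakCap_le`). For `Qw` the function is a truncated distance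
to `f '' A`. For `Qw'` it is a radial cutoff with `L * R` independent of the ring, and a large
relative distance in `Z` puts the images of `A` and `B` on the two sides of such a ring. -/

/-! ### Ahlfors regular spaces: mass, dimension, doubling -/

/-- The upper mass bound of an Ahlfors regular compact space holds at all radii. -/
theorem IsAhlforsRegular.exists_measure {W : Type*} [MetricSpace W] [CompactSpace W] [Nontrivial W]
    [MeasurableSpace W] [BorelSpace W] {Q : ℝ} (h : IsAhlforsRegular W Q) :
    0 < Q ∧ ∃ μ : Measure W, ∃ c C : ℝ, 0 < c ∧ 0 < C ∧
      (∀ (z : W) (r : ℝ), 0 < r → r ≤ Metric.diam (univ : Set W) →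
        ENNReal.ofReal (c * r ^ Q) ≤ μ (Metric.ball z r)) ∧
      ∀ (z : W) (r : ℝ), 0 < r → μ (Metric.ball z r) ≤ ENNReal.ofReal (C * r ^ Q) := by
  obtain rfl := BorelSpace.measurable_eq (α := W)
  obtain ⟨hQ, μ, c, C, hc, hC, h⟩ := h
  have hbdd : Bornology.IsBounded (univ : Set W) := isCompact_univ.isBounded
  have htop : Metric.ediam (univ : Set W) ≠ ∞ := hbdd.ediam_ne_top
  have hD : 0 < Metric.diam (univ : Set W) := by
    obtain ⟨x, y, hxy⟩ := exists_pair_ne W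
    exact (dist_pos.2 hxy).trans_le (Metric.dist_le_diam_of_mem hbdd trivial trivial)
  set D := Metric.diam (univ : Set W) with hDdef
  have hle : ∀ r, r ≤ D → ENNReal.ofReal r ≤ Metric.ediam (univ : Set W) := fun r hr =>
    ENNReal.ofReal_le_of_le_toReal hr
  have hfin : μ univ < ∞ := by
    obtain ⟨t, ht⟩ := isCompact_univ.elim_nhds_subcover (fun x : W => Metric.ball x D)
      (fun x _ => Metric.ball_mem_nhds x hD)
    refine (measure_mono ht.2).trans_lt ((measure_biUnion_finset_le t _).trans_lt ?_)
    exact ENNReal.sum_lt_top.2 fun x _ => (h x D hD (hle D le_rfl)).2.trans_lt ENNReal.ofReal_lt_top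
  -- Beyond the diameter the bound only has to absorb the total mass, which is finite by
  -- compactness.
  refine ⟨hQ, μ, c, max C ((μ univ).toReal / D ^ Q), hc, lt_max_of_lt_left hC,
    fun z r hr hrD => (h z r hr (hle r hrD)).1, fun z r hr => ?_⟩
  rcases le_total r D with hrD | hrD
  · refine (h z r hr (hle r hrD)).2.trans (ENNReal.ofReal_le_ofReal ?_)
    gcongr
    exact le_max_left _ _
  · calc μ (Metric.ball z r) ≤ μ univ := measure_mono (subset_univ _)
      _ = ENNReal.ofReal ((μ univ).toReal / D ^ Q * D ^ Q) := by
        rw [div_mul_cancel₀ _ (by positivity), ENNReal.ofReal_toReal hfin.ne]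
      _ ≤ _ := by
        apply ENNReal.ofReal_le_ofReal
        gcongr
        exact le_max_right _ _

/-- Mass distribution principle: a multiple of `μ` lies below the `Q`-dimensional Hausdorff measure.
-/
theorem IsAhlforsRegular.le_dimH {W : Type*} [MetricSpace W] [CompactSpace W] [Nontrivial W]
    {Q : ℝ} (h : IsAhlforsRegular W Q) : ENNReal.ofReal Q ≤ dimH (univ : Set W) := by
  borelize W
  obtain ⟨hQ, μ, c, C, hc, hC, hlow, hup⟩ := h.exists_measure
  -- The factor `2 ^ Q` arises because a set of diameter `d > 0` lies in an open ball of radius `2 *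
  -- d`.
  set a : ℝ≥0∞ := ENNReal.ofReal (C * 2 ^ Q) with ha
  have ha0 : a ≠ 0 := by simp only [ha, ne_eq, ENNReal.ofReal_eq_zero, not_le]; positivity
  have key : a⁻¹ • μ ≤ μH[Q] := by
    refine Measure.le_hausdorffMeasure Q _ 1 one_pos fun s hs => ?_
    rw [Measure.smul_apply, smul_eq_mul, mul_comm, ← div_eq_mul_inv]
    refine ENNReal.div_le_of_le_mul ?_
    rcases s.eq_empty_or_nonempty with rfl | ⟨x, hx⟩
    · simp
    have hst : Metric.ediam s ≠ ∞ := (hs.trans_lt ENNReal.one_lt_top).ne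
    have hb : Bornology.IsBounded s := Metric.isBounded_iff_ediam_ne_top.2 hst
    rcases (Metric.diam_nonneg (s := s)).eq_or_lt with h0 | h0
    · have hsx : ∀ r, 0 < r → s ⊆ Metric.ball x r := fun r hr y hy =>
        (Metric.dist_le_diam_of_mem hb hy hx).trans_lt (h0 ▸ hr)
      have hlim : Tendsto (fun r : ℝ => ENNReal.ofReal (C * r ^ Q)) (𝓝[>] 0) (𝓝 0) := by
        have : ContinuousAt (fun r : ℝ => ENNReal.ofReal (C * r ^ Q)) 0 :=
          ENNReal.continuous_ofReal.continuousAt.comp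
            (continuousAt_const.mul (Real.continuousAt_rpow_const _ _ (Or.inr hQ.le)))
        have h2 := this.tendsto
        simp only [Real.zero_rpow hQ.ne', mul_zero, ENNReal.ofReal_zero] at h2
        exact h2.mono_left nhdsWithin_le_nhds
      have : μ s ≤ 0 := ge_of_tendsto hlim (by
        filter_upwards [self_mem_nhdsWithin] with r hr
        exact (measure_mono (hsx r hr)).trans (hup x r hr))
      exact this.trans zero_le
    · have hsub : s ⊆ Metric.ball x (2 * Metric.diam s) := fun y hy =>
        (Metric.dist_le_diam_of_mem hb hy hx).trans_lt (by linarith)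
      refine (measure_mono hsub).trans ((hup x _ (by positivity)).trans ?_)
      have h0' : 0 < (Metric.ediam s).toReal := h0
      rw [← ENNReal.ofReal_toReal hst, ENNReal.ofReal_rpow_of_pos h0', ha,
        ← ENNReal.ofReal_mul (by positivity)]
      apply ENNReal.ofReal_le_ofReal
      rw [Real.mul_rpow (by norm_num) h0.le]
      exact le_of_eq (by rw [Metric.diam]; ring)
  have hQ' : ENNReal.ofReal Q = ((Q.toNNReal : ℝ≥0) : ℝ≥0∞) := rfl
  rw [hQ']
  refine le_dimH_of_hausdorffMeasure_ne_zero ?_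
  rw [Real.coe_toNNReal _ hQ.le]
  refine (lt_of_lt_of_le ?_ (key univ)).ne'
  rw [Measure.smul_apply, smul_eq_mul]
  have hpos : 0 < Metric.diam (univ : Set W) := by
    obtain ⟨x, y, hxy⟩ := exists_pair_ne W
    exact (dist_pos.2 hxy).trans_le
      (Metric.dist_le_diam_of_mem isCompact_univ.isBounded trivial trivial)
  obtain ⟨x⟩ : Nonempty W := inferInstance
  have h1 : 0 < μ univ := lt_of_lt_of_le (ENNReal.ofReal_pos.2 (by positivity))
    ((hlow x _ hpos le_rfl).trans (measure_mono (subset_univ _)))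
  exact ENNReal.mul_pos (ENNReal.inv_ne_zero.2 ENNReal.ofReal_ne_top) h1.ne'

theorem one_le_dimH_of_connectedSpace (W : Type*) [MetricSpace W] [ConnectedSpace W]
    [Nontrivial W] : 1 ≤ dimH (univ : Set W) := by
  obtain ⟨x, y, hxy⟩ := exists_pair_ne W
  have hl : LipschitzWith 1 (fun z => dist x z) := LipschitzWith.dist_right x
  have hsub : Icc (0 : ℝ) (dist x y) ⊆ (fun z => dist x z) '' univ := by
    have h := isPreconnected_univ.intermediate_value (s := (univ : Set W))
      (mem_univ x) (mem_univ y) (f := fun z => dist x z) hl.continuous.continuousOn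
    simpa using h
  calc (1 : ℝ≥0∞) = dimH (Icc (0 : ℝ) (dist x y)) := by
        rw [Real.dimH_of_nonempty_interior]
        · simp
        · rw [interior_Icc]
          exact nonempty_Ioo.2 (dist_pos.2 hxy)
    _ ≤ dimH ((fun z => dist x z) '' univ) := dimH_mono hsub
    _ ≤ dimH (univ : Set W) := hl.dimH_image_le _

/-- Ahlfors regular spaces are doubling. -/
theorem IsAhlforsRegular.exists_card_le {W : Type*} [MetricSpace W] [CompactSpace W]
    [Nontrivial W] {Q : ℝ} (h : IsAhlforsRegular W Q) {K : ℝ} (hK : 0 < K) :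
    ∃ N : ℕ, ∀ (x : W) (r : ℝ) (F : Finset W), 0 < r → (∀ y ∈ F, dist y x ≤ K * r) →
      ((F : Set W).Pairwise fun y z => r ≤ dist y z) → F.card ≤ N := by
  borelize W
  obtain ⟨hQ, μ, c, C, hc, hC, hlow, hup⟩ := h.exists_measure
  -- The second term compares the mass of a ball of radius `(K + 1) * r` with that of disjoint balls
  -- of radius `r / 2`. Two separated points are needed to know that `r / 2` is at most the
  -- diameter.
  refine ⟨max 1 ⌈C * (K + 1) ^ Q / (c * (1 / 2) ^ Q)⌉₊, fun x r F hr hF hsep => ?_⟩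
  rcases le_or_gt F.card 1 with h1 | h1
  · exact h1.trans (le_max_left _ _)
  refine le_trans ?_ (le_max_right _ _)
  obtain ⟨a, ha, b, hb, hab⟩ := Finset.one_lt_card.1 h1
  have hrD : r / 2 ≤ Metric.diam (univ : Set W) := by
    have := hsep ha hb hab
    have h3 := Metric.dist_le_diam_of_mem (isCompact_univ (X := W)).isBounded
      (mem_univ a) (mem_univ b)
    linarith
  have hdisj : (F : Set W).PairwiseDisjoint fun y => Metric.ball y (r / 2) := by
    intro y hy z hz hyz
    refine Metric.ball_disjoint_ball ?_
    have := hsep hy hz hyz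
    linarith
  have hsum : ∑ y ∈ F, μ (Metric.ball y (r / 2)) ≤ μ (Metric.ball x ((K + 1) * r)) := by
    rw [← measure_biUnion_finset hdisj fun y _ => measurableSet_ball]
    refine measure_mono (iUnion₂_subset fun y hy => Metric.ball_subset_ball' ?_)
    have := hF y hy
    linarith
  have h2 : (F.card : ℝ≥0∞) * ENNReal.ofReal (c * (r / 2) ^ Q) ≤
      ENNReal.ofReal (C * ((K + 1) * r) ^ Q) := by
    calc (F.card : ℝ≥0∞) * ENNReal.ofReal (c * (r / 2) ^ Q)
        = ∑ y ∈ F, ENNReal.ofReal (c * (r / 2) ^ Q) := by simp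
      _ ≤ ∑ y ∈ F, μ (Metric.ball y (r / 2)) :=
        Finset.sum_le_sum fun y _ => hlow y _ (by positivity) hrD
      _ ≤ _ := hsum.trans (hup x _ (by positivity))
  rw [← ENNReal.ofReal_natCast, ← ENNReal.ofReal_mul (by positivity),
    ENNReal.ofReal_le_ofReal_iff (by positivity)] at h2
  have h3 : (F.card : ℝ) ≤ C * (K + 1) ^ Q / (c * (1 / 2) ^ Q) := by
    rw [le_div_iff₀ (by positivity)]
    rw [Real.mul_rpow (by positivity) hr.le, div_eq_mul_one_div r 2,
      Real.mul_rpow hr.le (by norm_num)] at h2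
    have hrQ : 0 < r ^ Q := by positivity
    refine le_of_mul_le_mul_right ?_ hrQ
    linarith
  exact_mod_cast h3.trans (Nat.le_ceil _)

/-! ### Quasisymmetric control and points at prescribed distance -/

/-- `f` distorts ratios of distances by at most the control function `η`, where
`η t → 0` as `t → 0`; the degenerate ratios are included. -/
structure IsControl {Z W : Type*} [MetricSpace Z] [MetricSpace W] (f : Z → W) (η : ℝ → ℝ) :
    Prop where
  pos : ∀ t, 0 < t → 0 < η t
  tendsto : Tendsto η (𝓝[>] 0) (𝓝 0)
  dist_le : ∀ t, 0 < t → ∀ x y z : Z, dist x y ≤ t * dist x z →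
    dist (f x) (f y) ≤ η t * dist (f x) (f z)

theorem IsQuasisymmetry.exists_isControl {Z W : Type*} [MetricSpace Z] [MetricSpace W] {f : Z → W}
    (hf : IsQuasisymmetry f) : ∃ η, IsControl f η := by
  obtain ⟨hfh, η, hmono, hpos, hlim, h⟩ := hf
  refine ⟨η, hpos, hlim, fun t ht x y z hxy => ?_⟩
  rcases eq_or_ne x y with rfl | hne
  · simpa using mul_nonneg (hpos t ht).le dist_nonneg
  have h1 : 0 < dist x y := dist_pos.2 hne
  have hxz : x ≠ z := by
    rintro rfl
    simp at hxy
    exact hne hxy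
  have h2 : 0 < dist x z := dist_pos.2 hxz
  have h3 : 0 < dist (f x) (f z) := dist_pos.2 (hfh.injective.ne hxz)
  rw [← div_le_iff₀ h3]
  exact (h x y z hne hxz).trans (hmono (div_pos h1 h2) ht ((div_le_iff₀ h2).2 hxy))

/-- A farthest point from `z` is at distance at least half the diameter; connectedness supplies the
values in between. -/
theorem exists_dist_eq_of_le_half_diam {Z : Type*} [MetricSpace Z] [CompactSpace Z]
    [ConnectedSpace Z] (z : Z) {r : ℝ} (h0 : 0 ≤ r) (hr : r ≤ Metric.diam (univ : Set Z) / 2) : ∃ y, dist z y = r := by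
  obtain ⟨y, -, hy⟩ := isCompact_univ.exists_isMaxOn (univ_nonempty (α := Z))
    (f := fun y => dist z y) (by fun_prop)
  have hd : Metric.diam (univ : Set Z) ≤ 2 * dist z y := by
    refine Metric.diam_le_of_forall_dist_le (by positivity) fun a _ b _ => ?_
    have h1 : dist z a ≤ dist z y := hy (mem_univ a)
    have h2 : dist z b ≤ dist z y := hy (mem_univ b)
    linarith [dist_triangle_left a b z]
  have h := isPreconnected_univ.intermediate_value (s := (univ : Set Z))
    (mem_univ z) (mem_univ y) (f := fun y => dist z y) (by fun_prop)
  obtain ⟨w, -, hw⟩ := h ⟨by simpa using h0, (by linarith : r ≤ dist z y)⟩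
  exact ⟨w, hw⟩

theorem diam_univ_pos (Z : Type*) [MetricSpace Z] [CompactSpace Z] [Nontrivial Z] :
    0 < Metric.diam (univ : Set Z) := by
  obtain ⟨x, y, hxy⟩ := exists_pair_ne Z
  exact (dist_pos.2 hxy).trans_le
    (Metric.dist_le_diam_of_mem isCompact_univ.isBounded trivial trivial)

/-! ### Geometry and bounded degree of the filling -/

namespace HyperbolicFilling

variable {Z : Type*} [MetricSpace Z] (X : HyperbolicFilling Z)

/-- The separation of the vertices of level `k`. -/
noncomputable def sep (k : ℕ) : ℝ := Metric.diam (univ : Set Z) * X.s⁻¹ ^ k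

theorem s_pos : 0 < X.s := one_pos.trans X.one_lt_s

theorem sep_pos [CompactSpace Z] [Nontrivial Z] (k : ℕ) : 0 < X.sep k :=
  mul_pos (diam_univ_pos Z) (pow_pos (inv_pos.2 X.s_pos) k)

theorem sep_add (k m : ℕ) : X.sep (k + m) = X.s⁻¹ ^ m * X.sep k := by
  simp only [sep, pow_add]; ring

theorem sep_eq_mul_sep_succ (k : ℕ) : X.sep k = X.s * X.sep (k + 1) := by
  rw [sep_add, pow_one, ← mul_assoc, mul_inv_cancel₀ X.s_pos.ne', one_mul]

theorem sep_antitone : Antitone X.sep := fun _ _ h =>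
  mul_le_mul_of_nonneg_left (pow_le_pow_of_le_one (inv_pos.2 X.s_pos).le
    (inv_le_one_of_one_le₀ X.one_lt_s.le) h) Metric.diam_nonneg

theorem sep_le_diam (k : ℕ) : X.sep k ≤ Metric.diam (univ : Set Z) := by
  simpa [sep] using X.sep_antitone (Nat.zero_le k)

theorem sep_le_mul_sep {k l : ℕ} (h : l ≤ k + 1) : X.sep k ≤ X.s * X.sep l := by
  rw [sep_eq_mul_sep_succ]
  exact mul_le_mul_of_nonneg_left (X.sep_antitone h) X.s_pos.le

theorem sep_le_dist (v w : X.Vertex) (hl : v.level = w.level) (hne : v ≠ w) :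
    X.sep v.level ≤ dist v.center w.center := by
  obtain ⟨k, v, hv⟩ := v
  obtain ⟨l, w, hw⟩ := w
  obtain rfl : k = l := hl
  have hvw : v ≠ w := by rintro rfl; exact hne rfl
  change X.sep k ≤ dist v w
  rcases Nat.eq_zero_or_pos k with rfl | hk
  · obtain ⟨o, ho⟩ := X.pts_zero
    rw [ho] at hv hw
    exact absurd (hv.trans hw.symm) hvw
  · exact (X.pts_maximal k hk).prop hv hw hvw

theorem dist_le_of_adj [CompactSpace Z] [Nontrivial Z] {v w : X.Vertex} (h : X.graph.Adj v w) :
    dist v.center w.center ≤ 2 * (1 + X.s) * X.sep v.level := by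
  obtain ⟨-, ⟨h1, h2⟩, z, hz, hz'⟩ := h
  have h3 : dist z v.center < 2 * X.sep v.level := hz
  have h4 : dist z w.center < 2 * X.sep w.level := hz'
  have h5 := X.sep_le_mul_sep h1
  linarith [dist_triangle_left v.center w.center z]

/-- The graph of a hyperbolic filling has bounded degree. -/
theorem exists_card_adj_le [CompactSpace Z] [Nontrivial Z] {Q : ℝ} (hZ : IsAhlforsRegular Z Q) :
    ∃ N : ℕ, ∀ (v : X.Vertex) (F : Finset X.Vertex), (∀ w ∈ F, X.graph.Adj v w) → F.card ≤ N := by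
  classical
  have hs := X.s_pos
  obtain ⟨N, hN⟩ := hZ.exists_card_le (K := 2 * (1 + X.s) * X.s) (by positivity)
  -- Neighbours occupy at most three levels; within each one doubling applies.
  refine ⟨N * 3, fun v F hF => ?_⟩
  have himg : F.image (fun w => w.level) ⊆ Finset.Icc (v.level - 1) (v.level + 1) := by
    intro k hk
    obtain ⟨w, hw, rfl⟩ := Finset.mem_image.1 hk
    have := (hF w hw).2.1
    rw [Finset.mem_Icc]
    omega
  refine (Finset.card_le_mul_card_image F N fun k hk => ?_).trans
    (Nat.mul_le_mul_left N ((Finset.card_le_card himg).trans (by simp; omega)))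
  set G := F.filter fun w => w.level = k with hG
  have hGm : ∀ w ∈ G, X.graph.Adj v w ∧ w.level = k := fun w hw =>
    ⟨hF w (Finset.mem_filter.1 hw).1, (Finset.mem_filter.1 hw).2⟩
  have hsep : ∀ a ∈ G, ∀ b ∈ G, a ≠ b → X.sep k ≤ dist a.center b.center := by
    intro a ha b hb hab
    have ha' := (hGm a ha).2
    rw [← ha']
    exact X.sep_le_dist a b (ha'.trans (hGm b hb).2.symm) hab
  have hinj : Set.InjOn (fun w : X.Vertex => w.center) G := by
    intro a ha b hb hab
    by_contra hne
    have h1 := hsep a ha b hb hne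
    have h2 : dist a.center b.center = 0 := by
      rw [show a.center = b.center from hab, dist_self]
    linarith [X.sep_pos k]
  rw [← Finset.card_image_of_injOn hinj]
  refine hN v.center (X.sep k) _ (X.sep_pos k) ?_ ?_
  · intro y hy
    obtain ⟨w, hw, rfl⟩ := Finset.mem_image.1 hy
    obtain ⟨hadj, hwk⟩ := hGm w hw
    rw [dist_comm]
    refine (X.dist_le_of_adj hadj).trans ?_
    rw [mul_assoc _ X.s]
    have hle : k ≤ v.level + 1 := hwk ▸ hadj.2.1.2
    exact mul_le_mul_of_nonneg_left (X.sep_le_mul_sep hle) (by positivity)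
  · intro y hy z hz hyz
    obtain ⟨a, ha, rfl⟩ := Finset.mem_image.1 (Finset.mem_coe.1 hy)
    obtain ⟨b, hb, rfl⟩ := Finset.mem_image.1 (Finset.mem_coe.1 hz)
    exact hsep a ha b hb fun h => hyz (h ▸ rfl)

/-! ### Gauges: comparability and geometric decay -/

/-- `y z k` is a point at distance `s ^ (-k) / 2` (relative to the diameter) from `z`. -/
def IsScale (y : Z → ℕ → Z) : Prop := ∀ z k, dist z (y z k) = X.sep k / 2

theorem exists_isScale [CompactSpace Z] [ConnectedSpace Z] [Nontrivial Z] :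
    ∃ y, X.IsScale y := by
  have h : ∀ (z : Z) (k : ℕ), ∃ y, dist z y = X.sep k / 2 := fun z k =>
    exists_dist_eq_of_le_half_diam z (by have := X.sep_pos k; positivity) (by linarith [X.sep_le_diam k])
  choose y hy using h
  exact ⟨y, hy⟩

variable {X}

/-- The size in `W` of the ball of radius `s ^ (-k) / 2` around `z`. -/
def gauge {W : Type*} [MetricSpace W] (f : Z → W) (y : Z → ℕ → Z) (z : Z) (k : ℕ) : ℝ :=
  dist (f z) (f (y z k))

section Gauge

variable {W : Type*} [MetricSpace W] {f : Z → W} {η : ℝ → ℝ} {y : Z → ℕ → Z}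

theorem dist_le_gauge (hη : IsControl f η) (hy : X.IsScale y) {t : ℝ} (ht : 0 < t) {z w : Z}
    {k : ℕ} (h : dist z w ≤ t * X.sep k) : dist (f z) (f w) ≤ η (2 * t) * gauge f y z k :=
  hη.dist_le _ (by positivity) _ _ _ (by rw [hy]; linarith)

theorem gauge_le_dist (hη : IsControl f η) (hy : X.IsScale y) {z w : Z}
    {k : ℕ} (h : X.sep k / 2 ≤ dist z w) : gauge f y z k ≤ η 1 * dist (f z) (f w) :=
  hη.dist_le _ one_pos _ _ _ (by rw [hy]; linarith)

variable [CompactSpace Z] [Nontrivial Z]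

theorem gauge_pos (hf : Function.Injective f) (hy : X.IsScale y) (z : Z) (k : ℕ) :
    0 < gauge f y z k := by
  refine dist_pos.2 (hf.ne ?_)
  rw [← dist_pos, hy]
  exact half_pos (X.sep_pos k)

/-- Both `z'` and its scale point `y z' l` lie within a multiple of `X.sep k` of `z`, so their
images are within a multiple of the gauge at `z`. -/
theorem exists_gauge_le_gauge (hη : IsControl f η) (hy : X.IsScale y) {t : ℝ} (ht : 0 < t) :
    ∃ C, 0 < C ∧ ∀ z z' k l, dist z z' ≤ t * X.sep k → k ≤ l + 1 → l ≤ k + 1 →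
      gauge f y z' l ≤ C * gauge f y z k := by
  have hs := X.s_pos
  have h1 := hη.pos (2 * t) (by positivity)
  have h2 := hη.pos (2 * (t + X.s)) (by positivity)
  refine ⟨η (2 * t) + η (2 * (t + X.s)), by positivity, fun z z' k l hd hkl hlk => ?_⟩
  have h3 := X.sep_le_mul_sep hkl
  have h3' := X.sep_le_mul_sep hlk
  have h5 := X.sep_pos k
  have h4 : dist z (y z' l) ≤ (t + X.s) * X.sep k := by
    have := dist_triangle z z' (y z' l)
    have h6 := hy z' l
    have h7 := X.sep_pos l
    nlinarith
  have := dist_triangle_left (f z') (f (y z' l)) (f z)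
  have h5 := dist_le_gauge hη hy ht hd
  have h6 := dist_le_gauge hη hy (by positivity) h4
  rw [add_mul]
  exact this.trans (add_le_add h5 h6)

/-- The gauges decay geometrically along levels, uniformly in the point. -/
theorem exists_gauge_add_le (hη : IsControl f η) (hf : Function.Injective f) (hy : X.IsScale y) :
    ∃ C q : ℝ, 0 < C ∧ 0 < q ∧ q < 1 ∧ ∀ z k m,
      gauge f y z (k + m) ≤ C * q ^ m * gauge f y z k := by
  have hs := X.s_pos
  have hstep : ∀ z k m, gauge f y z (k + m) ≤ η (X.s⁻¹ ^ m) * gauge f y z k := fun z k m =>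
    hη.dist_le _ (by positivity) _ _ _ (by rw [hy, hy, X.sep_add]; linarith)
  have hlim : Tendsto (fun m : ℕ => X.s⁻¹ ^ m) atTop (𝓝[>] 0) :=
    tendsto_nhdsWithin_iff.2 ⟨tendsto_pow_atTop_nhds_zero_of_lt_one (inv_pos.2 hs).le
      (inv_lt_one_of_one_lt₀ X.one_lt_s), Eventually.of_forall fun m => by
        simp only [mem_Ioi]; positivity⟩
  -- Going `m₀` levels down halves the gauge. The rate `q` is the `m₀`-th root of `1 / 2`, and `C`
  -- covers the remainders below `m₀`.
  obtain ⟨m₀, hm₀, hm1⟩ := (((hη.tendsto.comp hlim).eventually_le_const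
    (show (0 : ℝ) < 1 / 2 by norm_num)).and (eventually_ge_atTop 1)).exists
  have hhalf : ∀ z k n, gauge f y z (k + m₀ * n) ≤ (1 / 2) ^ n * gauge f y z k := by
    intro z k n
    induction n with
    | zero => simp
    | succ n ih =>
      have h1 := hstep z (k + m₀ * n) m₀
      have h2 : η (X.s⁻¹ ^ m₀) ≤ 1 / 2 := hm₀
      have h3 := gauge_pos hf hy z (k + m₀ * n)
      calc gauge f y z (k + m₀ * (n + 1)) ≤ η (X.s⁻¹ ^ m₀) * gauge f y z (k + m₀ * n) := by
            rw [Nat.mul_succ, ← add_assoc]; exact h1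
        _ ≤ 1 / 2 * gauge f y z (k + m₀ * n) := by gcongr
        _ ≤ 1 / 2 * ((1 / 2) ^ n * gauge f y z k) := by gcongr
        _ = _ := by ring
  set q : ℝ := (1 / 2) ^ ((m₀ : ℝ)⁻¹) with hq
  have hq0 : 0 < q := by positivity
  have hq1 : q < 1 := Real.rpow_lt_one (by norm_num) (by norm_num) (by positivity)
  have hqm : q ^ m₀ = 1 / 2 := Real.rpow_inv_natCast_pow (by norm_num) (by omega)
  obtain ⟨C, hC, hCle⟩ : ∃ C : ℝ, 0 < C ∧ ∀ r < m₀, η (X.s⁻¹ ^ r) ≤ C := by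
    refine ⟨∑ r ∈ Finset.range m₀, η (X.s⁻¹ ^ r), Finset.sum_pos (fun r _ =>
      hη.pos _ (by positivity)) ⟨0, by simp; omega⟩, fun r hr => ?_⟩
    exact Finset.single_le_sum (f := fun r => η (X.s⁻¹ ^ r))
      (fun i _ => (hη.pos _ (by positivity)).le) (Finset.mem_range.2 hr)
  refine ⟨2 * C, q, by positivity, hq0, hq1, fun z k m => ?_⟩
  have hr : m % m₀ < m₀ := Nat.mod_lt _ (by omega)
  have hm : m = m % m₀ + m₀ * (m / m₀) := (Nat.mod_add_div m m₀).symm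
  have hg := gauge_pos hf hy z k
  have hpow : (1 / 2 : ℝ) ^ (m / m₀) ≤ 2 * q ^ m := by
    have h1 : q ^ m₀ ≤ q ^ (m % m₀) := pow_le_pow_of_le_one hq0.le hq1.le hr.le
    calc (1 / 2 : ℝ) ^ (m / m₀) = 2 * (q ^ m₀ * q ^ (m₀ * (m / m₀))) := by
          rw [pow_mul, hqm]; ring
      _ ≤ 2 * (q ^ (m % m₀) * q ^ (m₀ * (m / m₀))) := by gcongr
      _ = 2 * q ^ m := by rw [← pow_add, ← hm]
  calc gauge f y z (k + m) = gauge f y z (k + m % m₀ + m₀ * (m / m₀)) := by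
        rw [add_assoc, ← hm]
    _ ≤ (1 / 2) ^ (m / m₀) * gauge f y z (k + m % m₀) := hhalf _ _ _
    _ ≤ (2 * q ^ m) * (C * gauge f y z k) := by
        refine mul_le_mul hpow ((hstep z k _).trans ?_) (gauge_pos hf hy _ _).le (by positivity)
        gcongr
        exact hCle _ hr
    _ = _ := by ring

end Gauge

end HyperbolicFilling

/-! ### Geometric sums and the weak norm -/

/-- Decay is measured from the least index of `K`, whose term is at most `T`; the rest is dominated
by a geometric series. -/
theorem exists_sum_rpow_le_of_geometric {C q ε : ℝ} (hC : 0 < C) (hq0 : 0 < q) (hq1 : q < 1)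
    (hε : 0 < ε) : ∃ S : ℝ, 0 ≤ S ∧ ∀ (a : ℕ → ℝ) (T : ℝ) (K : Finset ℕ), 0 < T → (∀ k, 0 < a k) →
      (∀ k m, a (k + m) ≤ C * q ^ m * a k) → (∀ k ∈ K, a k ≤ T) →
        ∑ k ∈ K, a k ^ ε ≤ S * T ^ ε := by
  have hterm : ∀ m : ℕ, (C * q ^ m) ^ ε = C ^ ε * (q ^ ε) ^ m := fun m => by
    rw [Real.mul_rpow hC.le (by positivity), ← Real.rpow_natCast, ← Real.rpow_mul hq0.le,
      mul_comm, ← Real.rpow_natCast, ← Real.rpow_mul hq0.le, mul_comm (m : ℝ), mul_comm]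
  have hsum : Summable fun m : ℕ => (C * q ^ m) ^ ε := by
    simp only [hterm]
    exact (summable_geometric_of_lt_one (by positivity)
      (Real.rpow_lt_one hq0.le hq1 hε)).mul_left _
  refine ⟨∑' m : ℕ, (C * q ^ m) ^ ε, tsum_nonneg fun m => by positivity,
    fun a T K hT ha hdec hK => ?_⟩
  rcases K.eq_empty_or_nonempty with rfl | hne
  · rw [Finset.sum_empty]
    exact mul_nonneg (tsum_nonneg fun m => by positivity) (by positivity)
  have hmin : ∀ k ∈ K, K.min' hne + (k - K.min' hne) = k := fun k hk =>
    Nat.add_sub_cancel' (K.min'_le k hk)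
  calc ∑ k ∈ K, a k ^ ε ≤ ∑ k ∈ K, (C * q ^ (k - K.min' hne)) ^ ε * T ^ ε := by
        refine Finset.sum_le_sum fun k hk => ?_
        rw [← Real.mul_rpow (by positivity) hT.le]
        refine Real.rpow_le_rpow (ha k).le ?_ hε.le
        have h1 := hdec (K.min' hne) (k - K.min' hne)
        rw [hmin k hk] at h1
        exact h1.trans (mul_le_mul_of_nonneg_left (hK _ (K.min'_mem hne)) (by positivity))
    _ = (∑ m ∈ K.image fun k => k - K.min' hne, (C * q ^ m) ^ ε) * T ^ ε := by
        rw [Finset.sum_image, Finset.sum_mul]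
        intro k hk l hl hkl
        have h1 := hmin k hk
        have h2 := hmin l hl
        simp only at hkl
        omega
    _ ≤ _ := by
        gcongr
        exact hsum.sum_le_tsum _ fun m _ => by positivity

/-- Chebyshev's inequality. The summand `1` keeps the constant `C` positive when `S` is not. -/
theorem weakNorm_rpow_le {V : Type*} {p : ℝ} (hp : 0 < p) {g : V → ℝ≥0} {S : ℝ}
    (h : ∀ F : Finset V, ∑ x ∈ F, (g x : ℝ) ^ p ≤ S) :
    weakNorm p g ^ p ≤ ENNReal.ofReal S + 1 := by
  have htsum : ∑' x, (g x : ℝ≥0∞) ^ p ≤ ENNReal.ofReal S := by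
    rw [ENNReal.tsum_eq_iSup_sum]
    refine iSup_le fun F => ?_
    refine le_trans (le_of_eq ?_) (ENNReal.ofReal_le_ofReal (h F))
    rw [ENNReal.ofReal_sum_of_nonneg fun x _ => by positivity]
    refine Finset.sum_congr rfl fun x _ => ?_
    rw [← ENNReal.ofReal_rpow_of_nonneg (by positivity) hp.le, ENNReal.ofReal_coe_nnreal]
  set C : ℝ≥0 := (Real.toNNReal S + 1) ^ p⁻¹ with hC
  have hCp : (C : ℝ≥0∞) ^ p = ENNReal.ofReal S + 1 := by
    rw [← ENNReal.coe_rpow_of_nonneg _ hp.le, hC, NNReal.rpow_inv_rpow hp.ne']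
    simp [ENNReal.ofReal]
  rw [← hCp]
  refine ENNReal.rpow_le_rpow (iInf₂_le C ⟨NNReal.rpow_pos (by positivity), fun l hl => ?_⟩) hp.le
  have hl0 : (l : ℝ≥0∞) ^ p ≠ 0 := by
    rw [← ENNReal.coe_rpow_of_nonneg _ hp.le]
    exact_mod_cast (NNReal.rpow_pos hl).ne'
  have hlt : (l : ℝ≥0∞) ^ p ≠ ∞ := ENNReal.rpow_ne_top_of_nonneg hp.le ENNReal.coe_ne_top
  rw [ENNReal.le_div_iff_mul_le (Or.inl hl0) (Or.inl hlt), hCp]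
  calc (({x : V | l < g x}.encard : ℕ∞) : ℝ≥0∞) * (l : ℝ≥0∞) ^ p
      = ∑' _ : {x : V | l < g x}, (l : ℝ≥0∞) ^ p := (ENNReal.tsum_set_const _ _).symm
    _ ≤ ∑' x : {x : V | l < g x}, (g x : ℝ≥0∞) ^ p := by
        refine ENNReal.tsum_le_tsum fun x => ENNReal.rpow_le_rpow ?_ hp.le
        exact_mod_cast (le_of_lt x.2 : l ≤ g x)
    _ ≤ ∑' x, (g x : ℝ≥0∞) ^ p :=
        ENNReal.tsum_comp_le_tsum_of_injective Subtype.val_injective _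
    _ ≤ _ := htsum.trans le_self_add

/-! ### The `p`-sum of the gauges -/

namespace HyperbolicFilling

variable {Z : Type*} [MetricSpace Z] [CompactSpace Z] [Nontrivial Z] {X : HyperbolicFilling Z}
  {W : Type*} [MetricSpace W] {f : Z → W} {η : ℝ → ℝ} {y : Z → ℕ → Z}

/-- The `p`-sum of the gauges of all vertices that are contained in a ball of radius `R` of `W`, for
`p` larger than the dimension of `W`. -/
theorem exists_sum_gauge_rpow_le [CompactSpace W] [Nontrivial W] (hη : IsControl f η)
    (hf : Function.Bijective f) (hy : X.IsScale y) {Q p : ℝ} (hW : IsAhlforsRegular W Q)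
    (hp : Q < p) : ∃ S : ℝ, 0 ≤ S ∧ ∀ (x : W) (R : ℝ) (F : Finset X.Vertex), 0 < R →
      (∀ v ∈ F, dist x (f v.center) < R ∧ gauge f y v.center v.level < R) →
        ∑ v ∈ F, gauge f y v.center v.level ^ p ≤ S * R ^ p := by
  classical
  borelize W
  obtain ⟨hQ, μ, c, C, hc, hC, hlow, hup⟩ := hW.exists_measure
  obtain ⟨C₁, q, hC₁, hq0, hq1, hdec⟩ := exists_gauge_add_le hη hf.injective hy
  obtain ⟨C₂, hC₂, hcomp⟩ := exists_gauge_le_gauge hη hy one_pos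
  obtain ⟨S₁, hS₁, hseq⟩ := exists_sum_rpow_le_of_geometric hC₁ hq0 hq1 (sub_pos.2 hp)
  set ε := p - Q with hε
  have hε0 : 0 < ε := sub_pos.2 hp
  -- Division by `η 1` puts the preimage of `B v` within half the separation of `v.center`; `1 ≤ H`
  -- keeps the radius below `ρ v`, hence below the diameter of `W`.
  set H := max (η 1) 1 with hH
  have hH1 : 1 ≤ H := le_max_right _ _
  have hH0 : 0 < H := one_pos.trans_le hH1
  set ρ : X.Vertex → ℝ := fun v => gauge f y v.center v.level with hρ
  have hρ0 : ∀ v, 0 < ρ v := fun v => gauge_pos hf.injective hy _ _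
  set B : X.Vertex → Set W := fun v => Metric.ball (f v.center) (ρ v / H) with hB
  have hBd : ∀ v z, f z ∈ B v → dist v.center z < X.sep v.level / 2 := by
    intro v z hz
    by_contra! hcon
    have h1 := gauge_le_dist hη hy hcon
    have h2 : dist (f v.center) (f z) < ρ v / H := by rw [dist_comm]; exact hz
    rw [lt_div_iff₀ hH0] at h2
    have h3 : η 1 * dist (f v.center) (f z) ≤ H * dist (f v.center) (f z) :=
      mul_le_mul_of_nonneg_right (le_max_left _ _) dist_nonneg
    have h4 : ρ v ≤ η 1 * dist (f v.center) (f z) := h1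
    linarith
  -- A point lies in at most one `B v` per level, and there `ρ v` is comparable to the gauge at that
  -- point, so the sum becomes a geometric sum over levels.
  have hpt : ∀ (R : ℝ) (F : Finset X.Vertex), 0 < R → (∀ v ∈ F, ρ v < R) → ∀ w : W,
      ∑ v ∈ F with w ∈ B v, ρ v ^ ε ≤ C₂ ^ ε * (S₁ * (C₂ * R) ^ ε) := by
    intro R F hR hF w
    obtain ⟨z, rfl⟩ := hf.surjective w
    have hinj : Set.InjOn (fun v : X.Vertex => v.level) (F.filter fun v => f z ∈ B v) := by
      intro v hv u hu hvu
      by_contra hne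
      have h1 := hBd v z (Finset.mem_filter.1 hv).2
      have h2 := hBd u z (Finset.mem_filter.1 hu).2
      have h3 := X.sep_le_dist v u hvu hne
      have h4 : v.level = u.level := hvu
      rw [← h4] at h2
      linarith [dist_triangle_right v.center u.center z]
    have hclose : ∀ v, f z ∈ B v → ρ v ≤ C₂ * gauge f y z v.level ∧
        gauge f y z v.level ≤ C₂ * ρ v := by
      intro v hv
      have h1 := hBd v z hv
      have h2 := X.sep_pos v.level
      exact ⟨hcomp _ _ _ _ (by rw [dist_comm]; linarith) (by omega) (by omega),
        hcomp _ _ _ _ (by linarith) (by omega) (by omega)⟩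
    calc ∑ v ∈ F with f z ∈ B v, ρ v ^ ε
        ≤ ∑ v ∈ F with f z ∈ B v, C₂ ^ ε * gauge f y z v.level ^ ε := by
          refine Finset.sum_le_sum fun v hv => ?_
          have h1 := (hclose v (Finset.mem_filter.1 hv).2).1
          rw [← Real.mul_rpow hC₂.le (gauge_pos hf.injective hy _ _).le]
          exact Real.rpow_le_rpow (hρ0 v).le h1 hε0.le
      _ = C₂ ^ ε * ∑ k ∈ (F.filter fun v => f z ∈ B v).image fun v => v.level,
            gauge f y z k ^ ε := by
          rw [Finset.sum_image hinj, Finset.mul_sum]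
      _ ≤ _ := by
          refine mul_le_mul_of_nonneg_left (hseq _ _ _ (by positivity)
            (fun k => gauge_pos hf.injective hy z k) (hdec z) fun k hk => ?_) (by positivity)
          obtain ⟨v, hv, rfl⟩ := Finset.mem_image.1 hk
          obtain ⟨hvF, hvB⟩ := Finset.mem_filter.1 hv
          exact (hclose v hvB).2.trans (mul_le_mul_of_nonneg_left (hF v hvF).le hC₂.le)
  refine ⟨C₂ ^ ε * (S₁ * C₂ ^ ε) * (C * 2 ^ Q) * (H ^ Q / c), by positivity,
    fun x R F hR hF => ?_⟩
  set M := C₂ ^ ε * (S₁ * (C₂ * R) ^ ε) with hM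
  have hM0 : 0 ≤ M := by positivity
  have hBx : ∀ v ∈ F, B v ⊆ Metric.ball x (2 * R) := fun v hv => by
    refine Metric.ball_subset_ball' ?_
    have h1 := (hF v hv).2
    have h2 := (hF v hv).1
    have h3 : ρ v / H ≤ ρ v := div_le_self (hρ0 v).le hH1
    rw [dist_comm] at h2
    have h4 : ρ v < R := h1
    linarith
  have hint : ∑ v ∈ F, ENNReal.ofReal (ρ v ^ ε) * μ (B v) ≤
      ENNReal.ofReal M * μ (Metric.ball x (2 * R)) := by
    calc ∑ v ∈ F, ENNReal.ofReal (ρ v ^ ε) * μ (B v)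
        = ∑ v ∈ F, ∫⁻ w, (B v).indicator (fun _ => ENNReal.ofReal (ρ v ^ ε)) w ∂μ := by
          refine Finset.sum_congr rfl fun v _ => ?_
          rw [lintegral_indicator_const Metric.isOpen_ball.measurableSet]
      _ = ∫⁻ w, ∑ v ∈ F, (B v).indicator (fun _ => ENNReal.ofReal (ρ v ^ ε)) w ∂μ :=
          (lintegral_finsetSum _ fun v _ =>
            measurable_const.indicator Metric.isOpen_ball.measurableSet).symm
      _ ≤ ∫⁻ w, (Metric.ball x (2 * R)).indicator (fun _ => ENNReal.ofReal M) w ∂μ := by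
          refine lintegral_mono fun w => ?_
          by_cases hw : w ∈ Metric.ball x (2 * R)
          · simp only [indicator_apply, hw, if_true]
            rw [← Finset.sum_filter, ← ENNReal.ofReal_sum_of_nonneg
              fun v _ => Real.rpow_nonneg (hρ0 v).le _]
            exact ENNReal.ofReal_le_ofReal (hpt R F hR (fun v hv => (hF v hv).2) w)
          · rw [indicator_of_notMem hw, Finset.sum_eq_zero]
            exact fun v hv => indicator_of_notMem (fun h => hw (hBx v hv h)) _
      _ = _ := lintegral_indicator_const Metric.isOpen_ball.measurableSet _
  -- Lower regularity turns `ρ v ^ Q` into `μ (B v)`, leaving the exponent `ε = p - Q`.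
  have hlower : ENNReal.ofReal (∑ v ∈ F, ρ v ^ p * (c / H ^ Q)) ≤
      ∑ v ∈ F, ENNReal.ofReal (ρ v ^ ε) * μ (B v) := by
    rw [ENNReal.ofReal_sum_of_nonneg fun v _ =>
      mul_nonneg (Real.rpow_nonneg (hρ0 v).le _) (by positivity)]
    refine Finset.sum_le_sum fun v _ => ?_
    have h1 : ρ v ^ p * (c / H ^ Q) = ρ v ^ ε * (c * (ρ v / H) ^ Q) := by
      rw [Real.div_rpow (hρ0 v).le hH0.le, show p = ε + Q by rw [hε]; ring,
        Real.rpow_add (hρ0 v)]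
      ring
    rw [h1, ENNReal.ofReal_mul (Real.rpow_nonneg (hρ0 v).le _)]
    gcongr
    refine hlow _ _ (div_pos (hρ0 v) hH0) ((div_le_self (hρ0 v).le hH1).trans ?_)
    exact Metric.dist_le_diam_of_mem isCompact_univ.isBounded (mem_univ _) (mem_univ _)
  have hfinal : ENNReal.ofReal (∑ v ∈ F, ρ v ^ p * (c / H ^ Q)) ≤
      ENNReal.ofReal (M * (C * (2 * R) ^ Q)) := by
    rw [ENNReal.ofReal_mul hM0]
    refine hlower.trans (hint.trans ?_)
    gcongr
    exact hup x _ (by positivity)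
  rw [ENNReal.ofReal_le_ofReal_iff (by positivity), ← Finset.sum_mul] at hfinal
  have h2 : M * (C * (2 * R) ^ Q) =
      C₂ ^ ε * (S₁ * C₂ ^ ε) * (C * 2 ^ Q) * R ^ p := by
    rw [hM, Real.mul_rpow hC₂.le hR.le, Real.mul_rpow (by norm_num) hR.le,
      show p = ε + Q by rw [hε]; ring, Real.rpow_add hR]
    ring
  rw [h2, ← le_div_iff₀ (by positivity)] at hfinal
  refine hfinal.trans (le_of_eq ?_)
  field_simp

end HyperbolicFilling

/-! ### Admissible gradients and the general capacity bound -/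

theorem exists_le_dist_of_setDist_pos {Z W : Type*} [MetricSpace Z] [MetricSpace W]
    [CompactSpace W] {f : Z → W} (hf : IsHomeomorph f) {A B : Set Z} (h : 0 < setDist A B) :
    ∃ ε, 0 < ε ∧ ∀ a ∈ A, ∀ b ∈ B, ε ≤ dist (f a) (f b) := by
  obtain ⟨δ, hδ0, hδ⟩ := ENNReal.lt_iff_exists_nnreal_btwn.1 h
  have huc := CompactSpace.uniformContinuous_of_continuous (hf.homeomorph f).symm.continuous
  obtain ⟨ε, hε, hd⟩ := Metric.uniformContinuous_iff.1 huc δ (by exact_mod_cast hδ0)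
  refine ⟨ε, hε, fun a ha b hb => ?_⟩
  by_contra! hlt
  have hsymm : ∀ z, (hf.homeomorph f).symm (f z) = z := (hf.homeomorph f).symm_apply_apply
  have h1 := hd hlt
  rw [hsymm, hsymm] at h1
  have h2 : (δ : ℝ≥0∞) < edist a b := hδ.trans_le (iInf₂_le_of_le a ha (iInf₂_le b hb))
  rw [edist_nndist, ENNReal.coe_lt_coe] at h2
  rw [← coe_nndist, NNReal.coe_lt_coe] at h1
  exact lt_asymm h1 h2

namespace HyperbolicFilling

variable {Z : Type*} [MetricSpace Z] {X : HyperbolicFilling Z}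

/-- The gradient of a function on the vertices. -/
noncomputable def gradient (U : X.Vertex → ℝ) (e : X.Edge) : ℝ≥0 :=
  Sym2.lift ⟨fun v w => nndist (U v) (U w), fun v w => nndist_comm (U v) (U w)⟩ e.1

/-- The triangle inequality along the `2 * n` edges between times `-n` and `n` bounds the increment
of `U` by the sum; then `n` tends to infinity. -/
theorem one_le_tsum_gradient {U : X.Vertex → ℝ} (γ : X.BiPath) {α β : ℝ} (hαβ : 1 ≤ |α - β|)
    (hα : Tendsto (fun k => U (γ.vertex k)) atBot (𝓝 α))
    (hβ : Tendsto (fun k => U (γ.vertex k)) atTop (𝓝 β)) :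
    1 ≤ ∑' k : ℤ, (gradient U (γ.edge k) : ℝ≥0∞) := by
  have hle : ∀ n : ℕ, edist (U (γ.vertex (-n))) (U (γ.vertex n)) ≤
      ∑' k : ℤ, (gradient U (γ.edge k) : ℝ≥0∞) := by
    intro n
    have h := edist_le_range_sum_edist (fun i : ℕ => U (γ.vertex (-n + i))) (2 * n)
    have h2 : (-n + ((2 * n : ℕ) : ℤ) : ℤ) = n := by push_cast; ring
    simp only [Nat.cast_zero, add_zero, h2] at h
    refine h.trans ?_
    have hinj : Function.Injective fun i : ℕ => (-n + i : ℤ) := fun i j hij => by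
      simpa using hij
    refine le_trans ?_ (ENNReal.tsum_comp_le_tsum_of_injective hinj _)
    refine le_trans (le_of_eq ?_) (ENNReal.sum_le_tsum (Finset.range (2 * n)))
    refine Finset.sum_congr rfl fun i _ => ?_
    rw [edist_nndist]
    simp only [gradient, BiPath.edge, Sym2.lift_mk, Nat.cast_add, Nat.cast_one, add_assoc]
  have hneg : Tendsto (fun n : ℕ => (-n : ℤ)) atTop atBot :=
    tendsto_neg_atTop_atBot.comp tendsto_natCast_atTop_atTop
  have hlim := (hα.comp hneg).edist (hβ.comp tendsto_natCast_atTop_atTop)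
  refine le_trans ?_ (le_of_tendsto hlim (Eventually.of_forall hle))
  rw [edist_dist, Real.dist_eq]
  exact ENNReal.one_le_ofReal.2 hαβ

theorem card_edges_le {N : ℕ}
    (hN : ∀ (v : X.Vertex) (F : Finset X.Vertex), (∀ w ∈ F, X.graph.Adj v w) → F.card ≤ N)
    (v : X.Vertex) (F : Finset X.Edge) (hF : ∀ e ∈ F, v ∈ e.1) : F.card ≤ N := by
  classical
  have h : ∀ e : X.Edge, ∃ w, v ∈ e.1 → e.1 = s(v, w) := fun e => by
    by_cases hv : v ∈ e.1
    · obtain ⟨w, hw⟩ := Sym2.mem_iff_exists.1 hv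
      exact ⟨w, fun _ => hw⟩
    · exact ⟨v, fun h => absurd h hv⟩
  choose o ho using h
  have hinj : Set.InjOn o F := fun e he e' he' hee => by
    apply Subtype.ext
    rw [ho e (hF e he), ho e' (hF e' he'), hee]
  rw [← Finset.card_image_of_injOn hinj]
  refine hN v _ fun w hw => ?_
  obtain ⟨e, he, rfl⟩ := Finset.mem_image.1 hw
  have := e.2
  rwa [ho e (hF e he), SimpleGraph.mem_edgeSet] at this

/-- The scale points approach the same limit as the centers, because the radii vanish. -/
theorem BiPath.HasLimit.tendsto_gauge {W : Type*} [MetricSpace W] {f : Z → W} {y : Z → ℕ → Z}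
    (hf : Continuous f) (hy : X.IsScale y) {γ : X.BiPath}
    {l : Filter ℤ} {z : Z} (h : γ.HasLimit l z) :
    Tendsto (fun k => gauge f y (γ.vertex k).center (γ.vertex k).level) l (𝓝 0) := by
  have h1 : Tendsto (fun k => y (γ.vertex k).center (γ.vertex k).level) l (𝓝 z) := by
    refine h.1.congr_dist ?_
    have h2 : Tendsto (fun k => (γ.vertex k).radius / 4) l (𝓝 0) := by
      simpa using h.2.div_const 4
    refine h2.congr fun k => ?_
    rw [hy]
    simp only [Vertex.radius, sep]
    ring
  have h3 := ((hf.tendsto z).comp h.1).dist ((hf.tendsto z).comp h1)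
  simpa [gauge] using h3

variable [CompactSpace Z] [Nontrivial Z]
  {W : Type*} [MetricSpace W] {f : Z → W} {η : ℝ → ℝ} {y : Z → ℕ → Z}

/-- The variation of the gauge is included because the radial test function depends on distance plus
gauge. -/
theorem exists_dist_add_gauge_sub_le (hη : IsControl f η) (hf : Function.Injective f)
    (hy : X.IsScale y) : ∃ K, 0 < K ∧ ∀ v w : X.Vertex, X.graph.Adj v w →
      dist (f v.center) (f w.center) +
        |gauge f y v.center v.level - gauge f y w.center w.level| ≤
          K * gauge f y v.center v.level := by
  have hs := X.s_pos
  obtain ⟨C, hC, hcomp⟩ := exists_gauge_le_gauge hη hy (t := 2 * (1 + X.s)) (by positivity)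
  have hη' := hη.pos (2 * (2 * (1 + X.s))) (by positivity)
  refine ⟨η (2 * (2 * (1 + X.s))) + (1 + C), by positivity, fun v w h => ?_⟩
  have h1 := dist_le_gauge hη hy (by positivity) (X.dist_le_of_adj h)
  have h2 := hcomp _ _ _ _ (X.dist_le_of_adj h) h.2.1.1 h.2.1.2
  have h3 := gauge_pos hf hy v.center v.level
  have h4 := gauge_pos hf hy w.center w.level
  have h5 : |gauge f y v.center v.level - gauge f y w.center w.level| ≤
      (1 + C) * gauge f y v.center v.level := by
    rw [abs_le]
    constructor <;> nlinarith
  rw [add_mul]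
  exact add_le_add h1 h5

variable [CompactSpace W] [Nontrivial W]

/-- The weak capacity is controlled by functions on the vertices whose gradient is bounded by the
gauge and supported near a ball of radius `R` of `W`. -/
theorem exists_weakCap_le (hη : IsControl f η)
    (hf : Function.Bijective f) (hy : X.IsScale y) {Q Q' p : ℝ} (hZ : IsAhlforsRegular Z Q')
    (hW : IsAhlforsRegular W Q) (hp : Q < p) : ∃ S : ℝ,
      ∀ (U : X.Vertex → ℝ) (x : W) (R L : ℝ) (A B : Set Z), 0 < R → 0 < L →
      (∀ v w, X.graph.Adj v w → U v ≠ U w → ∃ u, (u = v ∨ u = w) ∧ dist x (f u.center) < R ∧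
        gauge f y u.center u.level < R ∧ |U v - U w| ≤ L * gauge f y u.center u.level) →
      (∀ γ : X.BiPath, (∃ a ∈ A, γ.HasLimit atBot a) → (∃ b ∈ B, γ.HasLimit atTop b) →
        ∃ α β : ℝ, 1 ≤ |α - β| ∧ Tendsto (fun k => U (γ.vertex k)) atBot (𝓝 α) ∧
          Tendsto (fun k => U (γ.vertex k)) atTop (𝓝 β)) →
      X.weakCap p A B ≤ ENNReal.ofReal (S * (L * R) ^ p) + 1 := by
  classical
  have hp0 : 0 < p := hW.1.trans hp
  obtain ⟨N, hN⟩ := X.exists_card_adj_le hZ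
  obtain ⟨S, -, hsum⟩ := exists_sum_gauge_rpow_le hη hf hy hW hp
  refine ⟨N * S, fun U x R L A B hR hL hU hlim => ?_⟩
  set ρ : X.Vertex → ℝ := fun v => gauge f y v.center v.level with hρ
  have hρ0 : ∀ v, 0 < ρ v := fun v => gauge_pos hf.injective hy _ _
  have hadm : X.IsAdmissible A B (gradient U) := fun γ hA hB => by
    obtain ⟨α, β, hαβ, hα, hβ⟩ := hlim γ hA hB
    exact one_le_tsum_gradient γ hαβ hα hβ
  refine (iInf₂_le _ hadm).trans (weakNorm_rpow_le hp0 fun F => ?_)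
  -- Each edge is charged to one endpoint `u` that controls its gradient; a vertex is charged at
  -- most `N` times.
  have hvert : ∀ e : X.Edge, ∃ u, u ∈ e.1 ∧ (gradient U e ≠ 0 → dist x (f u.center) < R ∧
      ρ u < R ∧ (gradient U e : ℝ) ≤ L * ρ u) := by
    rintro ⟨e, he⟩
    induction e using Sym2.ind with
    | _ v w =>
      have hvw : gradient U ⟨s(v, w), he⟩ = nndist (U v) (U w) := rfl
      by_cases h : U v = U w
      · exact ⟨v, Sym2.mem_mk_left v w, fun hne => absurd (by rw [hvw, h, nndist_self]) hne⟩
      · obtain ⟨u, huvw, h1, h2, h3⟩ := hU v w he h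
        refine ⟨u, Sym2.mem_iff.2 huvw, fun _ => ⟨h1, h2, ?_⟩⟩
        rw [hvw, coe_nndist, Real.dist_eq]
        exact h3
  choose g hg hgood using hvert
  set F' := F.filter fun e => gradient U e ≠ 0 with hF'
  calc ∑ e ∈ F, (gradient U e : ℝ) ^ p
      = ∑ e ∈ F', (gradient U e : ℝ) ^ p := by
        refine (Finset.sum_filter_of_ne (p := fun e => gradient U e ≠ 0) fun e _ hne h0 => hne ?_).symm
        rw [h0, NNReal.coe_zero, Real.zero_rpow hp0.ne']
    _ ≤ ∑ e ∈ F', (L * ρ (g e)) ^ p := Finset.sum_le_sum fun e he =>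
        Real.rpow_le_rpow (by positivity) (hgood e (Finset.mem_filter.1 he).2).2.2 hp0.le
    _ = ∑ u ∈ F'.image g, (F'.filter fun e => g e = u).card • (L * ρ u) ^ p :=
        Finset.sum_comp (fun u => (L * ρ u) ^ p) g
    _ ≤ ∑ u ∈ F'.image g, N * (L ^ p * ρ u ^ p) := by
        refine Finset.sum_le_sum fun u _ => ?_
        rw [nsmul_eq_mul, ← Real.mul_rpow hL.le (hρ0 u).le]
        have h1 := card_edges_le hN u (F'.filter fun e => g e = u) fun e he =>
          (Finset.mem_filter.1 he).2 ▸ hg e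
        have h2 : 0 ≤ L * ρ u := mul_nonneg hL.le (hρ0 u).le
        gcongr
    _ = N * L ^ p * ∑ u ∈ F'.image g, ρ u ^ p := by
        rw [Finset.mul_sum]
        exact Finset.sum_congr rfl fun _ _ => by ring
    _ ≤ N * L ^ p * (S * R ^ p) := by
        refine mul_le_mul_of_nonneg_left (hsum x R _ hR fun u hu => ?_) (by positivity)
        obtain ⟨e, he, rfl⟩ := Finset.mem_image.1 hu
        have := hgood e (Finset.mem_filter.1 he).2
        exact ⟨this.1, this.2.1⟩
    _ = _ := by
        rw [Real.mul_rpow hL.le hR.le]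
        ring

end HyperbolicFilling

/-! ### Capacity of separated sets and of rings -/

namespace HyperbolicFilling

variable {Z : Type*} [MetricSpace Z] {X : HyperbolicFilling Z} [CompactSpace Z] [Nontrivial Z]
  {W : Type*} [MetricSpace W] [CompactSpace W] [Nontrivial W] {f : Z → W} {η : ℝ → ℝ}
  {y : Z → ℕ → Z}

theorem weakCap_lt_top (hη : IsControl f η) (hf : IsHomeomorph f) (hy : X.IsScale y)
    {Q Q' p : ℝ} (hZ : IsAhlforsRegular Z Q') (hW : IsAhlforsRegular W Q) (hp : Q < p)
    {A B : Set Z} (hAB : 0 < setDist A B) : X.weakCap p A B < ∞ := by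
  obtain ⟨ε, hε, hsep⟩ := exists_le_dist_of_setDist_pos hf hAB
  obtain ⟨S, hS⟩ := exists_weakCap_le hη hf.bijective hy hZ hW hp
  obtain ⟨K, hK, hadj⟩ := exists_dist_add_gauge_sub_le hη hf.injective hy
  obtain ⟨x⟩ : Nonempty W := inferInstance
  have hdiam : ∀ a b : W, dist a b < Metric.diam (univ : Set W) + 1 := fun a b =>
    (Metric.dist_le_diam_of_mem isCompact_univ.isBounded (mem_univ a) (mem_univ b)).trans_lt
      (lt_add_one _)
  have hcont : Continuous fun z => min 1 (Metric.infDist (f z) (f '' A) / ε) :=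
    continuous_const.min (((Metric.continuous_infDist_pt _).comp hf.continuous).div_const ε)
  -- With `R` above the diameter of `W`, localization is automatic. The truncated distance is `0` on
  -- `A` and `1` on `B`, at slope `1 / ε`.
  refine (hS (fun v => min 1 (Metric.infDist (f v.center) (f '' A) / ε)) x
    (Metric.diam (univ : Set W) + 1) (K / ε) A B (by positivity) (by positivity) ?_ ?_).trans_lt
    (by simp)
  · intro v w hvw _
    refine ⟨v, Or.inl rfl, hdiam _ _, hdiam _ _, ?_⟩
    have h1 := hadj v w hvw
    have h2 : |Metric.infDist (f v.center) (f '' A) - Metric.infDist (f w.center) (f '' A)| ≤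
        dist (f v.center) (f w.center) := by
      simpa [Real.dist_eq] using
        (Metric.lipschitz_infDist_pt (f '' A)).dist_le_mul (f v.center) (f w.center)
    refine (abs_min_sub_min_le_max _ _ _ _).trans ?_
    rw [sub_self, abs_zero, max_eq_right (abs_nonneg _), ← sub_div, abs_div, abs_of_pos hε,
      div_mul_eq_mul_div]
    gcongr
    have h3 := abs_nonneg (gauge f y v.center v.level - gauge f y w.center w.level)
    linarith
  · rintro γ ⟨a, ha, hγa⟩ ⟨b, hb, hγb⟩
    refine ⟨_, _, ?_, (hcont.tendsto a).comp hγa.1, (hcont.tendsto b).comp hγb.1⟩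
    have h1 : Metric.infDist (f a) (f '' A) = 0 :=
      Metric.infDist_zero_of_mem (mem_image_of_mem f ha)
    have h2 : ε ≤ Metric.infDist (f b) (f '' A) := by
      refine (Metric.le_infDist ⟨f a, mem_image_of_mem f ha⟩).2 ?_
      rintro _ ⟨a', ha', rfl⟩
      rw [dist_comm]
      exact hsep a' ha' b hb
    rw [h1, min_eq_left ((one_le_div hε).2 h2)]
    simp

/-- Uniform bound for the weak capacity of ring domains of `W` of a fixed ratio. -/
theorem exists_weakCap_le_of_ring (hη : IsControl f η) (hf : IsHomeomorph f) (hy : X.IsScale y)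
    {Q Q' p : ℝ} (hZ : IsAhlforsRegular Z Q') (hW : IsAhlforsRegular W Q) (hp : Q < p) :
    ∃ M : ℝ≥0∞, M < ∞ ∧ ∀ (A B : Set Z) (x : W) (R : ℝ), 0 < R →
      ((∀ a ∈ A, 2 * dist x (f a) ≤ R) ∧ (∀ b ∈ B, R ≤ dist x (f b)) ∨
        (∀ b ∈ B, 2 * dist x (f b) ≤ R) ∧ (∀ a ∈ A, R ≤ dist x (f a))) →
      X.weakCap p A B ≤ M := by
  obtain ⟨S, hS⟩ := exists_weakCap_le hη hf.bijective hy hZ hW hp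
  obtain ⟨K, hK, hadj⟩ := exists_dist_add_gauge_sub_le hη hf.injective hy
  refine ⟨ENNReal.ofReal (S * (2 * K) ^ p) + 1, by simp, fun A B x R hR h => ?_⟩
  -- The cutoff rises from `0` at `R / 2` to `1` at `R` with slope `2 / R`, so `L * R = 2 * K`
  -- whatever the ring.
  set ψ : ℝ → ℝ := fun t => max 0 (min 1 (2 * t / R - 1)) with hψ
  have hψc : Continuous ψ := by fun_prop
  have hψ0 : ∀ t, 2 * t ≤ R → ψ t = 0 := fun t ht => by
    have : 2 * t / R ≤ 1 := (div_le_one hR).2 ht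
    exact max_eq_left ((min_le_right _ _).trans (by linarith))
  have hψ1 : ∀ t, R ≤ t → ψ t = 1 := fun t ht => by
    have : 2 ≤ 2 * t / R := by rw [le_div_iff₀ hR]; linarith
    simp only [hψ]
    rw [min_eq_left (by linarith), max_eq_right zero_le_one]
  have hψl : ∀ t u, |ψ t - ψ u| ≤ 2 / R * |t - u| := fun t u => by
    refine (abs_max_sub_max_le_max _ _ _ _).trans (max_le (by simp; positivity) ?_)
    refine (abs_min_sub_min_le_max _ _ _ _).trans (max_le (by simp; positivity) (le_of_eq ?_))
    rw [show 2 * t / R - 1 - (2 * u / R - 1) = 2 / R * (t - u) by ring, abs_mul,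
      abs_of_pos (show 0 < 2 / R by positivity)]
  -- Adding the gauge makes `τ v < R` bound both distance and gauge, while the limits at the ends of
  -- a path are unchanged.
  set τ : X.Vertex → ℝ := fun v => dist x (f v.center) + gauge f y v.center v.level with hτ
  have hdiff : ∀ v w, X.graph.Adj v w →
      |ψ (τ v) - ψ (τ w)| ≤ 2 * K / R * gauge f y v.center v.level := fun v w hvw => by
    have h1 : |τ v - τ w| ≤ K * gauge f y v.center v.level := by
      refine le_trans ?_ (hadj v w hvw)
      rw [hτ, add_sub_add_comm]
      refine (abs_add_le _ _).trans ?_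
      gcongr
      rw [dist_comm x, dist_comm x]
      exact abs_dist_sub_le _ _ _
    calc |ψ (τ v) - ψ (τ w)| ≤ 2 / R * |τ v - τ w| := hψl _ _
      _ ≤ 2 / R * (K * gauge f y v.center v.level) := by gcongr
      _ = _ := by ring
  have hlimit : ∀ (γ : X.BiPath) (l : Filter ℤ) (z : Z), γ.HasLimit l z →
      Tendsto (fun k => ψ (τ (γ.vertex k))) l (𝓝 (ψ (dist x (f z)))) := fun γ l z hz => by
    have h1 := hz.tendsto_gauge hf.continuous hy
    have h2 := ((hf.continuous.tendsto z).comp hz.1)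
    have h3 := (tendsto_const_nhds (x := x) (f := l)).dist h2
    have h4 := h3.add h1
    rw [add_zero] at h4
    exact (hψc.tendsto _).comp h4
  have hgood : ∀ v : X.Vertex, τ v < R →
      dist x (f v.center) < R ∧ gauge f y v.center v.level < R := fun v hv => by
    have h1 : 0 ≤ dist x (f v.center) := dist_nonneg
    have h2 := gauge_pos hf.injective hy v.center v.level
    simp only [hτ] at hv
    constructor <;> linarith
  have hfin := hS (fun v => ψ (τ v)) x R (2 * K / R) A B hR (by positivity)
    (fun v w hvw hne => ?_) fun γ hA hB => ?_
  · rwa [div_mul_cancel₀ _ hR.ne'] at hfin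
  · by_cases hv : τ v < R
    · exact ⟨v, Or.inl rfl, (hgood v hv).1, (hgood v hv).2, hdiff v w hvw⟩
    · by_cases hw : τ w < R
      · refine ⟨w, Or.inr rfl, (hgood w hw).1, (hgood w hw).2, ?_⟩
        rw [abs_sub_comm]
        exact hdiff w v hvw.symm
      · exact absurd (by rw [hψ1 _ (not_lt.1 hv), hψ1 _ (not_lt.1 hw)]) hne
  · obtain ⟨a, ha, hγa⟩ := hA
    obtain ⟨b, hb, hγb⟩ := hB
    refine ⟨_, _, ?_, hlimit γ _ a hγa, hlimit γ _ b hγb⟩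
    rcases h with ⟨hA, hB⟩ | ⟨hB, hA⟩
    · rw [hψ0 _ (hA a ha), hψ1 _ (hB b hb)]
      simp
    · rw [hψ1 _ (hA a ha), hψ0 _ (hB b hb)]
      simp

theorem exists_control_lt_top (hη : IsControl f η) (hf : IsHomeomorph f) (hy : X.IsScale y)
    {Q Q' p : ℝ} (hZ : IsAhlforsRegular Z Q') (hW : IsAhlforsRegular W Q) (hp : Q < p) :
    ∃ t₀ : ℝ, 0 < t₀ ∧ X.control p t₀ < ∞ := by
  obtain ⟨M, hM, hcap⟩ := exists_weakCap_le_of_ring hη hf hy hZ hW hp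
  obtain ⟨t, htη, ht⟩ := ((hη.tendsto.eventually_le_const
    (show (0 : ℝ) < 1 / 2 by norm_num)).and self_mem_nhdsWithin).exists
  replace ht : 0 < t := ht
  -- With `η t ≤ 1 / 2`, relative distance at least `t⁻¹` makes the image of the set of smaller
  -- diameter at most half as far from its base point as the other image.
  refine ⟨t⁻¹, inv_pos.2 ht, lt_of_le_of_lt (iSup₂_le fun A B => iSup_le ?_) hM⟩
  rintro ⟨-, -, hpos, hrel⟩
  obtain ⟨ε, hε, hsep⟩ := exists_le_dist_of_setDist_pos hf hpos
  have hdiam : ∀ a b : W, 2 * dist a b ≤ 2 * (Metric.diam (univ : Set W) + 1) := fun a b => by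
    have := Metric.dist_le_diam_of_mem (isCompact_univ (X := W)).isBounded
      (mem_univ a) (mem_univ b)
    linarith
  obtain ⟨x₀⟩ : Nonempty W := inferInstance
  rcases A.eq_empty_or_nonempty with rfl | ⟨a₀, ha₀⟩
  · exact hcap _ _ x₀ (2 * (Metric.diam (univ : Set W) + 1)) (by positivity)
      (Or.inr ⟨fun b _ => hdiam _ _, by simp⟩)
  rcases B.eq_empty_or_nonempty with rfl | ⟨b₀, hb₀⟩
  · exact hcap _ _ x₀ (2 * (Metric.diam (univ : Set W) + 1)) (by positivity)
      (Or.inl ⟨fun b _ => hdiam _ _, by simp⟩)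
  have hring : ∀ (A' B' : Set Z) (x : Z), B'.Nonempty → x ∈ A' →
      (∀ b ∈ B', ε ≤ dist (f x) (f b)) →
      (∀ a ∈ A', ∀ b ∈ B', ENNReal.ofReal t⁻¹ * edist x a ≤ edist x b) →
      ∃ R, 0 < R ∧ (∀ a ∈ A', 2 * dist (f x) (f a) ≤ R) ∧ ∀ b ∈ B', R ≤ dist (f x) (f b) := by
    intro A' B' x hB' hx hεx hd
    have hne := hB'.image f
    -- The outer radius is the distance from `f x` to the other image, positive by `ε`.
    refine ⟨Metric.infDist (f x) (f '' B'), hε.trans_le ?_, fun a ha => ?_, fun b hb =>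
      Metric.infDist_le_dist_of_mem (mem_image_of_mem f hb)⟩
    · exact (Metric.le_infDist hne).2 (forall_mem_image.2 hεx)
    · refine (Metric.le_infDist hne).2 (forall_mem_image.2 fun b hb => ?_)
      have h1 := hd a ha b hb
      rw [edist_dist, edist_dist, ← ENNReal.ofReal_mul (inv_pos.2 ht).le,
        ENNReal.ofReal_le_ofReal_iff dist_nonneg, inv_mul_le_iff₀ ht] at h1
      have h2 := hη.dist_le t ht _ _ _ h1
      have h3 : η t * dist (f x) (f b) ≤ 1 / 2 * dist (f x) (f b) :=
        mul_le_mul_of_nonneg_right htη dist_nonneg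
      linarith
  have hmul := ENNReal.mul_le_of_le_div hrel
  have hset : ∀ a ∈ A, ∀ b ∈ B, setDist A B ≤ edist a b := fun a ha b hb =>
    iInf₂_le_of_le a ha (iInf₂_le b hb)
  rcases le_total (Metric.ediam A) (Metric.ediam B) with hle | hle
  · rw [min_eq_left hle] at hmul
    obtain ⟨R, hR, h1, h2⟩ := hring A B a₀ ⟨b₀, hb₀⟩ ha₀ (hsep a₀ ha₀) fun a ha b hb =>
      (mul_le_mul_right (Metric.edist_le_ediam_of_mem ha₀ ha) _).trans
        (hmul.trans (hset a₀ ha₀ b hb))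
    exact hcap A B _ R hR (Or.inl ⟨h1, h2⟩)
  · rw [min_eq_right hle] at hmul
    obtain ⟨R, hR, h1, h2⟩ := hring B A b₀ ⟨a₀, ha₀⟩ hb₀
      (fun a ha => by rw [dist_comm]; exact hsep a ha b₀ hb₀) fun b hb a ha =>
      (mul_le_mul_right (Metric.edist_le_ediam_of_mem hb₀ hb) _).trans
        (hmul.trans (by rw [edist_comm]; exact hset a ha b₀ hb₀))
    exact hcap A B _ R hR (Or.inr ⟨h1, h2⟩)

end HyperbolicFilling

/-! ### Comparison of the exponents with the conformal dimension -/

/-- The critical exponents of `Z` are at most the Hausdorff dimension of every Ahlfors regular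
quasisymmetric image of `Z`. -/
theorem IsQuasisymmetry.critical_exponents_le_dimH {Z W : Type*} [MetricSpace Z] [CompactSpace Z]
    [ConnectedSpace Z] [Nontrivial Z] [MetricSpace W] {f : Z → W} (hf : IsQuasisymmetry f)
    {Q Q' : ℝ} (hZ : IsAhlforsRegular Z Q') (hW : IsAhlforsRegular W Q)
    (X : HyperbolicFilling Z) :
    X.Qw' ≤ dimH (univ : Set W) ∧ X.Qw ≤ dimH (univ : Set W) := by
  have hh := hf.1
  have : CompactSpace W := (hh.homeomorph f).compactSpace
  have : ConnectedSpace W := hh.surjective.connectedSpace hh.continuous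
  have : Nontrivial W := hh.injective.nontrivial
  obtain ⟨η, hη⟩ := hf.exists_isControl
  obtain ⟨y, hy⟩ := X.exists_isScale
  have hdim : ENNReal.ofReal (max 1 Q) ≤ dimH (univ : Set W) := by
    rw [ENNReal.ofReal_max, ENNReal.ofReal_one]
    exact max_le (one_le_dimH_of_connectedSpace W) hW.le_dimH
  have hofReal : ∀ ε : ℝ≥0, ENNReal.ofReal (max 1 Q + ε) = ENNReal.ofReal (max 1 Q) + ε :=
    fun ε => by
      rw [ENNReal.ofReal_add (zero_le_one.trans (le_max_left _ _)) ε.coe_nonneg,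
        ENNReal.ofReal_coe_nnreal]
  have hlt : ∀ ε : ℝ≥0, 0 < ε → 1 < max 1 Q + ε ∧ Q < max 1 Q + ε := fun ε hε =>
    ⟨(le_max_left _ _).trans_lt (lt_add_of_pos_right _ hε),
      (le_max_right _ _).trans_lt (lt_add_of_pos_right _ hε)⟩
  constructor
  · refine le_trans (ENNReal.le_of_forall_pos_le_add fun ε hε _ => ?_) hdim
    rw [← hofReal]
    exact iInf₂_le _ ⟨(hlt ε hε).1,
      HyperbolicFilling.exists_control_lt_top hη hh hy hZ hW (hlt ε hε).2⟩
  · refine le_trans (ENNReal.le_of_forall_pos_le_add fun ε hε _ => ?_) hdim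
    rw [← hofReal]
    exact iInf₂_le _ ⟨(hlt ε hε).1, fun A B _ _ hAB =>
      HyperbolicFilling.weakCap_lt_top hη hh hy hZ hW (hlt ε hε).2 hAB⟩

theorem mainTheorem6 {Z : Type*} [MetricSpace Z] [CompactSpace Z] [ConnectedSpace Z] [Nontrivial Z]
    (hZ : ∃ Q : ℝ, IsAhlforsRegular Z Q) (X : HyperbolicFilling Z) :
    X.Qw' ≤ arcDim Z ∧ X.Qw ≤ arcDim Z := by
  obtain ⟨Q', hQ'⟩ := hZ
  -- A separate `W` keeps the metric `θ` apart from the given metric on the same set.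
  have key {W : Type _} [MetricSpace W] {f : Z → W} (hf : IsQuasisymmetry f) {Q : ℝ}
      (hW : IsAhlforsRegular W Q) := hf.critical_exponents_le_dimH hQ' hW X
  constructor
  · refine le_iInf₂ fun θ hθ => ?_
    obtain ⟨hqs, Q, hQ⟩ := hθ
    exact (@key Z θ id hqs Q hQ).1
  · refine le_iInf₂ fun θ hθ => ?_
    obtain ⟨hqs, Q, hQ⟩ := hθ
    exact (@key Z θ id hqs Q hQ).2
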